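/- A probability measure $\mu$ on $\mathbb{R}$, the law of a real random variable $X$, is said to be of Lee--Yang type, written $\mu\in\mathcal{L}$, if (1) $X$ and $-X$ have the same distribution; (2) $\mathbb{E}\big[e^{bX^2}\big]<\infty$ for some $b>0$; and (3) every zero $z\in\mathbb{C}$ of the moment generating function $z\mapsto\mathbb{E}\big[e^{zX}\big]$ is purely imaginary, i.e. satisfies $\operatorname{Re}z=0$. Theorem. Let $(\mu_n)_{n\in\mathbb{N}}$ be a sequence in $\mathcal{L}$ (the constant $b$ in (2) may depend on $n$) that converges weakly to a probability measure $\mu$ on $\mathbb{R}$. Then $\mu\in\mathcal{L}$. In particular, there is $c>0$ such that $\mu\big((r,\infty)\big)\le e^{-cr^2}$ for all $r\ge 0$. -/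

import Mathlib

/-!
The moment generating function `f` of a law in `𝓛` is even, so `f z = g (z ^ 2)` with `g` entire of
order at most one, `g 0 = 1`, and all zeros of `g` negative. A factor `1 + w / a` of `g` satisfies
`Real.log (1 + x / a) / x ≤ 1 / a ≤ -Real.log (1 - s / a) / s` for `0 < x` and `0 < s < a`, hence
`‖g x‖ ^ s * ‖g (-s)‖ ^ x ≤ 1` as long as `g` has no zero in `(-s, 0]`. Since `g (-s)` is the value
of the characteristic function at `√s`, a lower bound for the characteristic function near the
origin becomes a sub-Gaussian bound for the law. The Hadamard product is not needed: on a disc of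
radius `R`, dividing out finitely many factors leaves the exponential of a function `h` with
`h 0 = 0`, and by the Borel-Carathéodory theorem the difference quotients of `h` at `0` vary by
`O(1 / R)` between `x` and `-s`.

Weak convergence makes that lower bound uniform, so the `μs n` are eventually sub-Gaussian with the
same constant. The limit inherits this, the moment generating functions converge locally uniformly
on `ℂ`, and by Hurwitz's theorem the limit has no zero off the imaginary axis.
-/

open MeasureTheory ProbabilityTheory Filter Topology

/-- A probability measure `μ` on `ℝ`, the law of a random variable `X`, is of Lee-Yang type. -/
structure IsLeeYang (μ : ProbabilityMeasure ℝ) : Prop where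
  /-- `X` and `-X` have the same distribution. -/
  symmetric : (μ : Measure ℝ).map (fun x : ℝ => -x) = (μ : Measure ℝ)
  /-- `𝔼 exp (b X²) < ∞` for some `b > 0`. -/
  exp_sq_integrable : ∃ b : ℝ, 0 < b ∧ Integrable (fun x : ℝ => Real.exp (b * x ^ 2)) (μ : Measure ℝ)
  /-- All the zeros of `z ↦ 𝔼 exp (z X)` lie on the imaginary axis; the expectation converges for
  every complex `z` by the previous field. -/
  zeros_imaginary : ∀ z : ℂ, complexMGF (fun x : ℝ => x) (μ : Measure ℝ) z = 0 → z.re = 0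

/-- The Lee-Yang class `𝓛`. -/
def leeYangClass : Set (ProbabilityMeasure ℝ) := {μ | IsLeeYang μ}

/-! ### Entire functions with negative zeros -/

lemma differentiable_of_comp_sq {E : Type*} [NormedAddCommGroup E] [NormedSpace ℂ E]
    [CompleteSpace E] {g : ℂ → E} (hg : Differentiable ℂ fun z => g (z ^ 2)) :
    Differentiable ℂ g := by
  have sq_sqrt (v : ℂ) : (v ^ (1 / 2 : ℂ)) ^ 2 = v := by simp
  have differentiableAt_of_ne_zero {w : ℂ} (hw : w ≠ 0) : DifferentiableAt ℂ g w := by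
    have eq_comp : g = (fun z => g (z ^ 2)) ∘
        fun v => w ^ (1 / 2 : ℂ) * (v / w) ^ (1 / 2 : ℂ) := by
      funext v
      simp only [Function.comp_apply, mul_pow, sq_sqrt, mul_div_cancel₀ v hw]
    have differentiableAt_sqrt : DifferentiableAt ℂ (fun v : ℂ => (v / w) ^ (1 / 2 : ℂ)) w :=
      (differentiableAt_id.div_const w).cpow_const (by simp [hw])
    rw [eq_comp]
    exact (hg _).comp w (differentiableAt_sqrt.const_mul _)
  have continuousAt_zero : ContinuousAt g 0 := by
    have eq_comp : g = (fun z => g (z ^ 2)) ∘ fun v => v ^ (1 / 2 : ℂ) :=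
      funext fun v => by simp only [Function.comp_apply, sq_sqrt]
    have continuousAt_sqrt : ContinuousAt (fun v : ℂ => v ^ (1 / 2 : ℂ)) 0 :=
      ContinuousAt.comp (f := fun v : ℂ => (v, (1 / 2 : ℂ)))
        (Complex.continuousAt_cpow_zero_of_re_pos (by norm_num)) (by fun_prop)
    rw [eq_comp]
    exact hg.continuous.continuousAt.comp continuousAt_sqrt
  intro w
  rcases eq_or_ne w 0 with rfl | hw
  · exact (Complex.analyticAt_of_differentiable_on_punctured_nhds_of_continuousAt
      (eventually_nhdsWithin_of_forall fun _ => differentiableAt_of_ne_zero)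
      continuousAt_zero).differentiableAt
  · exact differentiableAt_of_ne_zero hw

lemma exists_differentiable_comp_sq_eq {E : Type*} [NormedAddCommGroup E] [NormedSpace ℂ E]
    [CompleteSpace E] {f : ℂ → E} (hf : Differentiable ℂ f) (heven : f.Even) :
    ∃ g : ℂ → E, Differentiable ℂ g ∧ ∀ z, g (z ^ 2) = f z := by
  have comp_sq (z : ℂ) : f ((z ^ 2) ^ (1 / 2 : ℂ)) = f z := by
    have sq_eq : ((z ^ 2) ^ (1 / 2 : ℂ)) ^ 2 = z ^ 2 := by simp
    rcases sq_eq_sq_iff_eq_or_eq_neg.1 sq_eq with h | h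
    · rw [h]
    · rw [h, heven]
  exact ⟨fun w => f (w ^ (1 / 2 : ℂ)), differentiable_of_comp_sq (by simpa only [comp_sq]), comp_sq⟩

lemma eventually_ne_zero_of_differentiable {f : ℂ → ℂ} (hf : Differentiable ℂ f)
    (hf₀ : f ≠ 0) (z : ℂ) : ∀ᶠ v in 𝓝[≠] z, f v ≠ 0 := by
  refine (hf.analyticAt z).eventually_eq_zero_or_eventually_ne_zero.resolve_left fun h => hf₀ ?_
  exact AnalyticOnNhd.eq_of_eventuallyEq (fun w _ => hf.analyticAt w)
    analyticOnNhd_const h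

lemma exists_eq_pow_mul_of_differentiable {f : ℂ → ℂ} (hf : Differentiable ℂ f) (hf₀ : f ≠ 0)
    (z₀ : ℂ) : ∃ (n : ℕ) (h : ℂ → ℂ), Differentiable ℂ h ∧ h z₀ ≠ 0 ∧
      ∀ z, f z = (z - z₀) ^ n * h z := by
  obtain ⟨p, hp⟩ := hf.analyticAt z₀
  have p_ne_zero : p ≠ 0 := fun h =>
    ((eventually_ne_zero_of_differentiable hf hf₀ z₀).and
      ((hp.locally_zero_iff.2 h).filter_mono nhdsWithin_le_nhds)).exists.elim fun _ hv => hv.1 hv.2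
  have differentiable_dslope {h : ℂ → ℂ} (hh : Differentiable ℂ h) :
      Differentiable ℂ (dslope h z₀) :=
    differentiableOn_univ.1 ((Complex.differentiableOn_dslope univ_mem).2 hh.differentiableOn)
  exact ⟨p.order, _, Function.Iterate.rec (fun h => Differentiable ℂ h) hf
      (fun _ hh => differentiable_dslope hh) _,
    hp.iterate_dslope_fslope_ne_zero p_ne_zero, hp.eq_pow_order_mul_iterate_dslope⟩

lemma exists_multiset_prod_one_sub_div_mul_finset {g : ℂ → ℂ} (hg : Differentiable ℂ g)
    (hg₀ : g 0 ≠ 0) (T : Finset ℂ) :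
    ∃ (S : Multiset ℂ) (F : ℂ → ℂ), Differentiable ℂ F ∧ (∀ a ∈ S, a ∈ T ∧ g a = 0) ∧
      (∀ w, g w = (S.map fun a => 1 - w / a).prod * F w) ∧ ∀ a ∈ T, F a ≠ 0 := by
  classical
  induction T using Finset.induction_on with
  | empty => exact ⟨0, g, hg, by simp, by simp, by simp⟩
  | insert t T _ ih =>
    obtain ⟨S, F, hF, hS, g_eq, F_ne_zero⟩ := ih
    have F_zero : F 0 ≠ 0 := fun h => hg₀ (by rw [g_eq, h, mul_zero])
    obtain ⟨n, H, hH, H_ne_zero, F_eq⟩ :=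
      exists_eq_pow_mul_of_differentiable hF (fun h => F_zero (congrFun h 0)) t
    by_cases hn : n = 0
    · subst hn
      simp only [pow_zero, one_mul] at F_eq
      refine ⟨S, F, hF, fun a ha => ⟨Finset.mem_insert_of_mem (hS a ha).1, (hS a ha).2⟩, g_eq, ?_⟩
      exact (Finset.forall_mem_insert _ _ _).2 ⟨F_eq t ▸ H_ne_zero, F_ne_zero⟩
    have g_t : g t = 0 := by simp [g_eq, F_eq, hn]
    have t_ne_zero : t ≠ 0 := fun h => hg₀ (h ▸ g_t)
    refine ⟨S + Multiset.replicate n t, fun w => (-t) ^ n * H w, hH.const_mul _, ?_, ?_, ?_⟩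
    · intro a ha
      rcases Multiset.mem_add.1 ha with ha | ha
      · exact ⟨Finset.mem_insert_of_mem (hS a ha).1, (hS a ha).2⟩
      · rw [Multiset.eq_of_mem_replicate ha]
        exact ⟨Finset.mem_insert_self _ _, g_t⟩
    · intro w
      have sub_eq : w - t = (1 - w / t) * -t := by field_simp; ring
      rw [g_eq, F_eq, sub_eq, mul_pow, Multiset.map_add, Multiset.prod_add,
        Multiset.map_replicate, Multiset.prod_replicate]
      ring
    · refine (Finset.forall_mem_insert _ _ _).2 ⟨?_, fun a ha => ?_⟩
      · exact mul_ne_zero (pow_ne_zero _ (neg_ne_zero.2 t_ne_zero)) H_ne_zero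
      · refine mul_ne_zero (pow_ne_zero _ (neg_ne_zero.2 t_ne_zero)) fun h => F_ne_zero a ha ?_
        rw [F_eq, h, mul_zero]

lemma exists_multiset_prod_one_sub_div_mul {g : ℂ → ℂ} (hg : Differentiable ℂ g)
    (hg₀ : g 0 ≠ 0) {K : Set ℂ} (hK : IsCompact K) :
    ∃ (S : Multiset ℂ) (F : ℂ → ℂ), Differentiable ℂ F ∧ (∀ a ∈ S, a ∈ K ∧ g a = 0) ∧
      (∀ w, g w = (S.map fun a => 1 - w / a).prod * F w) ∧ ∀ w ∈ K, F w ≠ 0 := by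
  have codiscrete : g ⁻¹' {0}ᶜ ∈ codiscreteWithin K :=
    codiscreteWithin_mono (Set.subset_univ K)
      (AnalyticOnNhd.preimage_zero_mem_codiscrete (fun w _ => hg.analyticAt w) hg₀)
  have finite_zeros : (K \ g ⁻¹' {0}ᶜ).Finite :=
    hK.finite_sdiff_of_mem_codiscreteWithin codiscrete
  obtain ⟨S, F, hF, hS, g_eq, F_ne_zero⟩ :=
    exists_multiset_prod_one_sub_div_mul_finset hg hg₀ finite_zeros.toFinset
  refine ⟨S, F, hF, fun a ha => ⟨?_, (hS a ha).2⟩, g_eq, fun w hw h => F_ne_zero w ?_ h⟩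
  · exact (finite_zeros.mem_toFinset.1 (hS a ha).1).1
  · simp [hw, g_eq, h]

lemma exists_exp_eqOn_ball {F : ℂ → ℂ} {c : ℂ} {R : ℝ}
    (hF : DifferentiableOn ℂ F (Metric.ball c R))
    (F_ne_zero : ∀ w ∈ Metric.ball c R, F w ≠ 0) (hFc : F c = 1) :
    ∃ h : ℂ → ℂ, DifferentiableOn ℂ h (Metric.ball c R) ∧ h c = 0 ∧
      Set.EqOn (fun w => Complex.exp (h w)) F (Metric.ball c R) := by
  have differentiableOn_logDeriv :
      DifferentiableOn ℂ (fun w => deriv F w / F w) (Metric.ball c R) :=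
    (hF.deriv Metric.isOpen_ball).div hF F_ne_zero
  obtain ⟨h, h_c, hasDerivAt_h⟩ := differentiableOn_logDeriv.isExactOn_ball.with_val_at c 0
  refine ⟨h, fun w hw => (hasDerivAt_h w hw).differentiableAt.differentiableWithinAt, h_c,
    fun w hw => ?_⟩
  have hasDerivAt_mul_exp_neg (v : ℂ) (hv : v ∈ Metric.ball c R) :
      HasDerivAt (fun v => F v * Complex.exp (-h v)) 0 v := by
    have hasDerivAt_F := (hF.differentiableAt (Metric.isOpen_ball.mem_nhds hv)).hasDerivAt
    convert! hasDerivAt_F.mul (hasDerivAt_h v hv).neg.cexp using 1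
    have := F_ne_zero v hv
    field_simp
    ring
  have mul_exp_neg_eq : F w * Complex.exp (-h w) = F c * Complex.exp (-h c) :=
    Metric.isOpen_ball.is_const_of_deriv_eq_zero (convex_ball c R).isPreconnected
      (fun v hv => (hasDerivAt_mul_exp_neg v hv).differentiableAt.differentiableWithinAt)
      (fun v hv => (hasDerivAt_mul_exp_neg v hv).deriv) hw
      (Metric.mem_ball_self (Metric.nonempty_ball.1 ⟨w, hw⟩))
  rw [h_c, hFc, neg_zero, Complex.exp_zero, mul_one, Complex.exp_neg] at mul_exp_neg_eq
  exact (eq_of_mul_inv_eq_one mul_exp_neg_eq).symm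

lemma dist_dslope_zero_le_of_re_le {h : ℂ → ℂ} {R M : ℝ} (hM : 0 < M)
    (hh : DifferentiableOn ℂ h (Metric.ball 0 R)) (h_zero : h 0 = 0)
    (re_le : ∀ w ∈ Metric.ball (0 : ℂ) R, (h w).re ≤ M) {x y : ℂ}
    (hx : ‖x‖ < R / 8) (hy : ‖y‖ < R / 8) :
    dist (dslope h 0 x) (dslope h 0 y) ≤ 32 * M / R ^ 2 * dist x y := by
  have hR : 0 < R := by linarith [norm_nonneg x]
  have half_subset : Metric.ball (0 : ℂ) (R / 2) ⊆ Metric.ball 0 R :=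
    Metric.ball_subset_ball (by linarith)
  have norm_le : Set.MapsTo h (Metric.ball 0 (R / 2)) (Metric.closedBall (h 0) (2 * M)) := by
    intro w hw
    have w_lt := mem_ball_zero_iff.1 hw
    rw [h_zero, mem_closedBall_zero_iff]
    refine (Complex.borelCaratheodory_zero hM hh re_le hR (half_subset hw) h_zero).trans ?_
    rw [div_le_iff₀ (by linarith)]
    exact mul_le_mul_of_nonneg_left (by linarith) (by positivity)
  have norm_dslope_le {w : ℂ} (hw : w ∈ Metric.ball (0 : ℂ) (R / 2)) :
      ‖dslope h 0 w‖ ≤ 2 * M / (R / 2) :=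
    Complex.norm_dslope_le_div_of_mapsTo_ball (hh.mono half_subset) norm_le hw
  have quarter_subset : Metric.ball y (R / 4) ⊆ Metric.ball 0 (R / 2) :=
    Metric.ball_subset_ball' (by rw [dist_zero_right]; linarith)
  have maps_dslope : Set.MapsTo (dslope h 0) (Metric.ball y (R / 4))
      (Metric.closedBall (dslope h 0 y) (2 * (2 * M / (R / 2)))) := by
    intro v hv
    rw [Metric.mem_closedBall, dist_eq_norm, two_mul]
    exact (norm_sub_le _ _).trans (add_le_add (norm_dslope_le (quarter_subset hv))
      (norm_dslope_le (mem_ball_zero_iff.2 (by linarith))))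
  have hxy : x ∈ Metric.ball y (R / 4) := by
    rw [Metric.mem_ball, dist_eq_norm]
    linarith [norm_sub_le x y]
  have differentiableOn_dslope : DifferentiableOn ℂ (dslope h 0) (Metric.ball 0 R) :=
    (Complex.differentiableOn_dslope (Metric.ball_mem_nhds _ hR)).2 hh
  convert Complex.dist_le_div_mul_dist_of_mapsTo_ball
    (differentiableOn_dslope.mono (quarter_subset.trans half_subset)) maps_dslope hxy using 2
  field_simp
  ring

lemma norm_rpow_mul_norm_rpow_le_of_ne_zero {F : ℂ → ℂ} {R M x s : ℝ} (hM : 0 < M)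
    (hF : DifferentiableOn ℂ F (Metric.ball 0 R)) (hF₀ : F 0 = 1)
    (F_ne_zero : ∀ w ∈ Metric.ball (0 : ℂ) R, F w ≠ 0)
    (norm_le : ∀ w ∈ Metric.ball (0 : ℂ) R, ‖F w‖ ≤ Real.exp M)
    (hx : 0 < x) (hxR : x < R / 8) (hs : 0 < s) (hsR : s < R / 8) :
    ‖F x‖ ^ s * ‖F (-s)‖ ^ x ≤ Real.exp (32 * M / R ^ 2 * (x + s) * (x * s)) := by
  obtain ⟨h, hh, h_zero, exp_h⟩ := exists_exp_eqOn_ball hF F_ne_zero hF₀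
  have norm_F {w : ℂ} (hw : ‖w‖ < R / 8) : ‖F w‖ = Real.exp (h w).re := by
    rw [← Complex.norm_exp, ← exp_h (mem_ball_zero_iff.2 (by linarith [norm_nonneg w]))]
  have re_le (w : ℂ) (hw : w ∈ Metric.ball (0 : ℂ) R) : (h w).re ≤ M := by
    rw [← Real.exp_le_exp, ← Complex.norm_exp]
    exact (congrArg norm (exp_h hw)).trans_le (norm_le w hw)
  have norm_x : ‖(x : ℂ)‖ = x := Complex.norm_of_nonneg hx.le
  have norm_s : ‖(-s : ℂ)‖ = s := by rw [norm_neg, Complex.norm_of_nonneg hs.le]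
  have dist_xs : dist (x : ℂ) (-s) = x + s := by
    rw [dist_eq_norm, sub_neg_eq_add, ← Complex.ofReal_add, Complex.norm_of_nonneg (by positivity)]
  have dslope_x : dslope h 0 x = h x / (x : ℂ) := by
    rw [dslope_of_ne _ (by exact_mod_cast hx.ne'), slope_def_field, h_zero, sub_zero, sub_zero]
  have dslope_s : dslope h 0 (-s) = -(h (-s) / (s : ℂ)) := by
    rw [dslope_of_ne _ (by simp [hs.ne']), slope_def_field, h_zero, sub_zero, sub_zero, div_neg]
  have re_add_le : (h x).re / x + (h (-s)).re / s ≤ 32 * M / R ^ 2 * (x + s) := by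
    have := (Complex.re_le_norm _).trans ((dist_eq_norm _ _).symm.trans_le
      (dist_dslope_zero_le_of_re_le hM hh h_zero re_le (norm_x.trans_lt hxR) (norm_s.trans_lt hsR)))
    rwa [dist_xs, dslope_x, dslope_s, sub_neg_eq_add, Complex.add_re, Complex.div_ofReal_re,
      Complex.div_ofReal_re] at this
  rw [norm_F (norm_x.trans_lt hxR), norm_F (norm_s.trans_lt hsR), ← Real.exp_mul, ← Real.exp_mul,
    ← Real.exp_add, Real.exp_le_exp]
  calc (h x).re * s + (h (-s)).re * x = ((h x).re / x + (h (-s)).re / s) * (x * s) := by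
        field_simp
    _ ≤ _ := mul_le_mul_of_nonneg_right re_add_le (by positivity)

lemma one_add_div_rpow_mul_one_sub_div_rpow_le_one {b x s : ℝ} (hx : 0 ≤ x) (hs : 0 ≤ s)
    (hsb : s ≤ b) : (1 + x / b) ^ s * (1 - s / b) ^ x ≤ 1 := by
  have hb : 0 ≤ b := hs.trans hsb
  have one_sub_nonneg : 0 ≤ 1 - s / b := sub_nonneg.2 (div_le_one_of_le₀ hsb hb)
  calc (1 + x / b) ^ s * (1 - s / b) ^ x
      ≤ Real.exp (x / b) ^ s * Real.exp (-(s / b)) ^ x := by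
        gcongr
        · exact (add_comm _ _).trans_le (Real.add_one_le_exp _)
        · exact (sub_eq_neg_add _ _).trans_le (Real.add_one_le_exp _)
    _ = 1 := by
        rw [← Real.exp_mul, ← Real.exp_mul, ← Real.exp_add, Real.exp_eq_one_iff]
        ring

lemma norm_prod_one_sub_div_rpow_mul_le_one {S : Multiset ℂ} {x s : ℝ} (hx : 0 ≤ x) (hs : 0 ≤ s)
    (hS : ∀ a ∈ S, a.im = 0 ∧ a.re ≤ -s) :
    ‖(S.map fun a => 1 - (x : ℂ) / a).prod‖ ^ s *
      ‖(S.map fun a => 1 - (-s : ℂ) / a).prod‖ ^ x ≤ 1 := by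
  have factor_le_one {a : ℂ} (ha : a.im = 0 ∧ a.re ≤ -s) :
      ‖1 - (x : ℂ) / a‖ ^ s * ‖1 - (-s : ℂ) / a‖ ^ x ≤ 1 := by
    obtain ⟨b, hsb, rfl⟩ : ∃ b : ℝ, s ≤ b ∧ a = -(b : ℂ) :=
      ⟨-a.re, by linarith, by apply Complex.ext <;> simp [ha.1]⟩
    have hb : 0 ≤ b := hs.trans hsb
    have norm_x : ‖1 - (x : ℂ) / -(b : ℂ)‖ = 1 + x / b := by
      rw [div_neg, sub_neg_eq_add]
      exact_mod_cast Complex.norm_of_nonneg (r := 1 + x / b) (by positivity)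
    have norm_s : ‖1 - (-s : ℂ) / -(b : ℂ)‖ = 1 - s / b := by
      rw [neg_div_neg_eq]
      exact_mod_cast Complex.norm_of_nonneg (sub_nonneg.2 (div_le_one_of_le₀ hsb hb))
    rw [norm_x, norm_s]
    exact one_add_div_rpow_mul_one_sub_div_rpow_le_one hx hs hsb
  induction S using Multiset.induction_on with
  | empty => simp
  | cons a S ih =>
    rw [Multiset.forall_mem_cons] at hS
    simp only [Multiset.map_cons, Multiset.prod_cons, norm_mul]
    rw [Real.mul_rpow (norm_nonneg _) (norm_nonneg _),
      Real.mul_rpow (norm_nonneg _) (norm_nonneg _), mul_mul_mul_comm]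
    exact mul_le_one₀ (factor_le_one hS.1) (by positivity) (ih hS.2)

lemma one_le_norm_prod_one_sub_div {S : Multiset ℂ} {R : ℝ} {w : ℂ}
    (hS : ∀ a ∈ S, a ≠ 0 ∧ ‖a‖ ≤ R) (hw : 2 * R ≤ ‖w‖) :
    1 ≤ ‖(S.map fun a => 1 - w / a).prod‖ := by
  induction S using Multiset.induction_on with
  | empty => simp
  | cons a S ih =>
    rw [Multiset.forall_mem_cons] at hS
    obtain ⟨⟨a_ne_zero, a_le⟩, hS⟩ := hS
    rw [Multiset.map_cons, Multiset.prod_cons, norm_mul]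
    refine one_le_mul_of_one_le_of_one_le ?_ (ih hS)
    have two_le : 2 ≤ ‖w / a‖ := by
      rw [norm_div, le_div_iff₀ (norm_pos_iff.2 a_ne_zero)]
      linarith
    have := norm_sub_norm_le (w / a) 1
    rw [norm_one, norm_sub_rev] at this
    linarith

lemma norm_le_of_eq_prod_one_sub_div_mul {g F : ℂ → ℂ} {S : Multiset ℂ} {R C : ℝ} (hR : 0 < R)
    (hF : Differentiable ℂ F) (g_eq : ∀ w, g w = (S.map fun a => 1 - w / a).prod * F w)
    (hS : ∀ a ∈ S, a ≠ 0 ∧ ‖a‖ ≤ R) (norm_le : ∀ w, ‖w‖ = 2 * R → ‖g w‖ ≤ C) {w : ℂ}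
    (hw : ‖w‖ ≤ 2 * R) : ‖F w‖ ≤ C := by
  have two_mul_ne_zero : 2 * R ≠ 0 := by positivity
  refine Complex.norm_le_of_forall_mem_frontier_norm_le (U := Metric.ball (0 : ℂ) (2 * R))
    Metric.isBounded_ball hF.diffContOnCl (fun v hv => ?_) ?_
  · rw [frontier_ball _ two_mul_ne_zero, mem_sphere_zero_iff_norm] at hv
    calc ‖F v‖ ≤ ‖(S.map fun a => 1 - v / a).prod‖ * ‖F v‖ :=
          le_mul_of_one_le_left (norm_nonneg _) (one_le_norm_prod_one_sub_div hS hv.ge)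
      _ = ‖g v‖ := by rw [g_eq, norm_mul]
      _ ≤ C := norm_le v hv
  · rwa [closure_ball _ two_mul_ne_zero, mem_closedBall_zero_iff]

lemma norm_rpow_mul_norm_rpow_le_of_zeros_le {g : ℂ → ℂ} {R M x s : ℝ} (hM : 0 < M)
    (hg : Differentiable ℂ g) (hg₀ : g 0 = 1) (zeros : ∀ w, g w = 0 → w.im = 0 ∧ w.re ≤ -s)
    (norm_le : ∀ w, ‖w‖ = 2 * R → ‖g w‖ ≤ Real.exp M)
    (hx : 0 < x) (hxR : x < R / 8) (hs : 0 < s) (hsR : s < R / 8) :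
    ‖g x‖ ^ s * ‖g (-s)‖ ^ x ≤ Real.exp (32 * M / R ^ 2 * (x + s) * (x * s)) := by
  have hR : 0 < R := by linarith
  obtain ⟨S, F, hF, hS, g_eq, F_ne_zero⟩ := exists_multiset_prod_one_sub_div_mul hg
    (hg₀ ▸ one_ne_zero) (isCompact_closedBall (0 : ℂ) R)
  have hF₀ : F 0 = 1 := by simpa [hg₀] using (g_eq 0).symm
  have S_ne_zero (a : ℂ) (ha : a ∈ S) : a ≠ 0 ∧ ‖a‖ ≤ R :=
    ⟨fun h => by simpa [h, hg₀] using (hS a ha).2, mem_closedBall_zero_iff.1 (hS a ha).1⟩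
  have norm_F_le (w : ℂ) (hw : w ∈ Metric.ball (0 : ℂ) R) : ‖F w‖ ≤ Real.exp M :=
    norm_le_of_eq_prod_one_sub_div_mul hR hF g_eq S_ne_zero norm_le
      (by linarith [mem_ball_zero_iff.1 hw])
  rw [g_eq, g_eq, norm_mul, norm_mul, Real.mul_rpow (norm_nonneg _) (norm_nonneg _),
    Real.mul_rpow (norm_nonneg _) (norm_nonneg _), mul_mul_mul_comm]
  refine (mul_le_of_le_one_left (by positivity) ?_).trans
    (norm_rpow_mul_norm_rpow_le_of_ne_zero hM hF.differentiableOn hF₀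
      (fun w hw => F_ne_zero w (Metric.ball_subset_closedBall hw)) norm_F_le hx hxR hs hsR)
  exact norm_prod_one_sub_div_rpow_mul_le_one hx.le hs.le fun a ha => zeros a (hS a ha).2

lemma norm_rpow_mul_norm_rpow_le_one_of_zeros_le {g : ℂ → ℂ} {M : ℝ → ℝ} {x s : ℝ}
    (hg : Differentiable ℂ g) (hg₀ : g 0 = 1) (zeros : ∀ w, g w = 0 → w.im = 0 ∧ w.re ≤ -s)
    (norm_le : ∀ w, ‖g w‖ ≤ Real.exp (M ‖w‖)) (hM : M =o[atTop] fun R => R ^ 2)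
    (hx : 0 < x) (hs : 0 < s) : ‖g x‖ ^ s * ‖g (-s)‖ ^ x ≤ 1 := by
  have le_exp : ∀ᶠ R : ℝ in atTop, ‖g x‖ ^ s * ‖g (-s)‖ ^ x ≤
      Real.exp (32 * (|M (2 * R)| + 1) / R ^ 2 * (x + s) * (x * s)) := by
    filter_upwards [eventually_gt_atTop (8 * x), eventually_gt_atTop (8 * s)] with R hxR hsR
    refine norm_rpow_mul_norm_rpow_le_of_zeros_le (by positivity) hg hg₀ zeros (fun w hw => ?_)
      hx (by linarith) hs (by linarith)
    refine (norm_le w).trans (Real.exp_le_exp.2 ?_)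
    rw [hw]
    linarith [le_abs_self (M (2 * R))]
  have isLittleO_comp : (fun R => |M (2 * R)|) =o[atTop] fun R : ℝ => R ^ 2 := by
    refine (hM.comp_tendsto (tendsto_id.const_mul_atTop two_pos)).abs_left.trans_isBigO ?_
    simpa only [Function.comp_def, id, mul_pow] using
      (Asymptotics.isBigO_refl (fun R : ℝ => R ^ 2) atTop).const_mul_left (2 ^ 2)
  have isLittleO_const : (fun _ : ℝ => (1 : ℝ)) =o[atTop] fun R : ℝ => R ^ 2 :=
    (Asymptotics.isLittleO_one_left_iff ℝ).2
      (tendsto_norm_atTop_atTop.comp (tendsto_pow_atTop two_ne_zero))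
  have tendsto_bound : Tendsto (fun R : ℝ =>
      Real.exp (32 * (|M (2 * R)| + 1) / R ^ 2 * (x + s) * (x * s))) atTop (𝓝 1) := by
    have isLittleO_add := (isLittleO_comp.add isLittleO_const).const_mul_left 32
    have := (isLittleO_add.tendsto_div_nhds_zero.mul_const (x + s)).mul_const (x * s)
    simpa only [zero_mul, Real.exp_zero] using this.rexp
  exact ge_of_tendsto tendsto_bound le_exp

/-! ### Limits of holomorphic functions -/

lemma tendstoLocallyUniformlyOn_of_isBoundedUnder_norm {ι E : Type*} [NormedAddCommGroup E]
    [NormedSpace ℂ E] {l : Filter ι} [NeBot l] {f : ι → ℂ → E} {g : ℂ → E} {U : Set ℂ}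
    (hU : IsOpen U) (hf : ∀ᶠ n in l, DifferentiableOn ℂ (f n) U)
    (hbdd : ∀ z ∈ U, (l ×ˢ 𝓝 z).IsBoundedUnder (· ≤ ·) fun p => ‖f p.1 p.2‖)
    (hlim : ∀ z ∈ U, Tendsto (fun n => f n z) l (𝓝 (g z))) :
    TendstoLocallyUniformlyOn f g l U := by
  rw [Metric.tendstoLocallyUniformlyOn_iff]
  intro ε hε z hz
  obtain ⟨C, hC⟩ := hbdd z hz
  obtain ⟨p, hp, q, hq, norm_le⟩ := eventually_prod_iff.1 (eventually_map.1 hC)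
  obtain ⟨r, hr, ball_subset⟩ := Metric.mem_nhds_iff.1 (inter_mem hq (hU.mem_nhds hz))
  have dist_le : ∀ᶠ n in l, ∀ w ∈ Metric.ball z r, dist (f n w) (f n z) ≤ 2 * C / r * dist w z := by
    filter_upwards [hf, hp] with n hfn hpn w hw
    refine Complex.dist_le_div_mul_dist_of_mapsTo_ball
      (hfn.mono fun v hv => (ball_subset hv).2) (fun v hv => ?_) hw
    rw [Metric.mem_closedBall, dist_eq_norm, two_mul]
    exact (norm_sub_le _ _).trans (add_le_add (norm_le hpn (ball_subset hv).1)
      (norm_le hpn (ball_subset (Metric.mem_ball_self hr)).1))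
  have dist_limit_le (w : ℂ) (hw : w ∈ Metric.ball z r) :
      dist (g w) (g z) ≤ 2 * C / r * dist w z :=
    le_of_tendsto ((hlim w (ball_subset hw).2).dist (hlim z hz)) (dist_le.mono fun n hn => hn w hw)
  have tendsto_modulus : Tendsto (fun w => 2 * C / r * dist w z) (𝓝 z) (𝓝 0) :=
    (show Continuous fun w => 2 * C / r * dist w z by fun_prop).tendsto' z 0 (by simp)
  have near : ∀ᶠ w in 𝓝 z, w ∈ Metric.ball z r ∧ 2 * C / r * dist w z < ε / 3 :=
    (eventually_mem_set.2 (Metric.ball_mem_nhds z hr)).and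
      (tendsto_modulus.eventually_lt_const (by positivity))
  refine ⟨_, mem_nhdsWithin_of_mem_nhds near, ?_⟩
  filter_upwards [dist_le, Metric.tendsto_nhds.1 (hlim z hz) (ε / 3) (by positivity)]
    with n dist_le_n dist_lt w hw
  calc dist (g w) (f n w) ≤ dist (g w) (g z) + dist (g z) (f n z) + dist (f n z) (f n w) :=
        dist_triangle4 _ _ _ _
    _ < ε / 3 + ε / 3 + ε / 3 := by
        rw [dist_comm (g z) (f n z), dist_comm (f n z) (f n w)]
        linarith [dist_limit_le w hw.1, dist_le_n w hw.1, hw.2]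
    _ = ε := by ring

lemma le_norm_of_forall_mem_sphere_le_norm {f : ℂ → ℂ} {c : ℂ} {r m : ℝ} (hm : 0 < m) (hr : 0 < r)
    (hf : DiffContOnCl ℂ f (Metric.ball c r)) (f_ne_zero : ∀ w ∈ Metric.closedBall c r, f w ≠ 0)
    (le_norm : ∀ w ∈ Metric.sphere c r, m ≤ ‖f w‖) {z : ℂ} (hz : z ∈ Metric.closedBall c r) :
    m ≤ ‖f z‖ := by
  have closure_eq := closure_ball c hr.ne'
  have norm_inv_le : ‖(f z)⁻¹‖ ≤ m⁻¹ :=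
    Complex.norm_le_of_forall_mem_frontier_norm_le Metric.isBounded_ball
      (hf.inv (closure_eq ▸ f_ne_zero))
      (fun w hw => by
        rw [frontier_ball c hr.ne'] at hw
        rw [Pi.inv_apply, norm_inv]
        exact inv_anti₀ hm (le_norm w hw)) (closure_eq ▸ hz)
  rw [norm_inv] at norm_inv_le
  exact (inv_le_inv₀ (norm_pos_iff.2 (f_ne_zero z hz)) hm).1 norm_inv_le

lemma ne_zero_of_tendstoLocallyUniformlyOn {ι : Type*} {l : Filter ι} [NeBot l]
    {f : ι → ℂ → ℂ} {g : ℂ → ℂ} {U : Set ℂ} {z : ℂ} (hU : U ∈ 𝓝 z)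
    (hf : ∀ᶠ n in l, DifferentiableOn ℂ (f n) U) (f_ne_zero : ∀ᶠ n in l, ∀ w ∈ U, f n w ≠ 0)
    (hlim : TendstoLocallyUniformlyOn f g l U) (g_ne_zero : ∀ᶠ w in 𝓝[≠] z, g w ≠ 0) :
    g z ≠ 0 := by
  obtain ⟨r, hr, closedBall_subset⟩ := Metric.nhds_basis_closedBall.mem_iff.1
    (inter_mem (eventually_nhdsWithin_iff.1 g_ne_zero) hU)
  have closedBall_subset_U : Metric.closedBall z r ⊆ U := fun w hw => (closedBall_subset hw).2
  have sphere_subset : Metric.sphere z r ⊆ U :=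
    Metric.sphere_subset_closedBall.trans closedBall_subset_U
  have tendstoUniformlyOn : TendstoUniformlyOn f g l (Metric.sphere z r) :=
    (tendstoLocallyUniformlyOn_iff_tendstoUniformlyOn_of_compact (isCompact_sphere z r)).1
      (hlim.mono sphere_subset)
  have continuousOn_g : ContinuousOn g (Metric.sphere z r) :=
    tendstoUniformlyOn.continuousOn
      (hf.mono fun n hn => hn.continuousOn.mono sphere_subset).frequently
  obtain ⟨v, hv, g_v_le⟩ := (isCompact_sphere z r).exists_isMinOn
    (NormedSpace.sphere_nonempty.2 hr.le) continuousOn_g.norm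
  have norm_pos : 0 < ‖g v‖ := norm_pos_iff.2
    ((closedBall_subset (Metric.sphere_subset_closedBall hv)).1 (Metric.ne_of_mem_sphere hv hr.ne'))
  have le_norm : ∀ᶠ n in l, ‖g v‖ / 2 ≤ ‖f n z‖ := by
    filter_upwards [hf, f_ne_zero, Metric.tendstoUniformlyOn_iff.1 tendstoUniformlyOn
      (‖g v‖ / 2) (by positivity)] with n hfn f_ne_zero_n dist_lt
    refine le_norm_of_forall_mem_sphere_le_norm (by positivity) hr
      (hfn.diffContOnCl_ball closedBall_subset_U)
      (fun w hw => f_ne_zero_n w (closedBall_subset_U hw)) (fun w hw => ?_)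
      (Metric.mem_closedBall_self hr.le)
    have g_v_le_w : ‖g v‖ ≤ ‖g w‖ := g_v_le hw
    have := dist_lt w hw
    rw [dist_eq_norm] at this
    linarith [norm_sub_norm_le (g w) (f n w)]
  have := ge_of_tendsto (hlim.tendsto_at (mem_of_mem_nhds hU)).norm le_norm
  exact norm_pos_iff.1 ((half_pos norm_pos).trans_le this)

/-! ### Integrals along weakly convergent families -/

lemma map_eq_self_of_tendsto {ι X : Type*} [TopologicalSpace X] [HasOuterApproxClosed X]
    [MeasurableSpace X] [BorelSpace X] {l : Filter ι} [NeBot l] {μs : ι → ProbabilityMeasure X}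
    {μ : ProbabilityMeasure X} (hlim : Tendsto μs l (𝓝 μ)) {φ : X → X} (hφ : Continuous φ)
    (hμs : ∀ n, (μs n : Measure X).map φ = μs n) : (μ : Measure X).map φ = μ := by
  have tendsto_map := ProbabilityMeasure.tendsto_map_of_tendsto_of_continuous μs μ hlim hφ
  have map_eq (n : ι) : (μs n).map hφ.measurable.aemeasurable = μs n := Subtype.ext (hμs n)
  simp only [map_eq] at tendsto_map
  exact congrArg ProbabilityMeasure.toMeasure (tendsto_nhds_unique tendsto_map hlim)

lemma integrable_and_integral_le_of_tendsto {X : Type*} [TopologicalSpace X]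
    [HasOuterApproxClosed X] [MeasurableSpace X] [OpensMeasurableSpace X]
    {μs : ℕ → ProbabilityMeasure X} {μ : ProbabilityMeasure X} (hlim : Tendsto μs atTop (𝓝 μ))
    {f : X → ℝ} (hf : Continuous f) (f_nonneg : 0 ≤ f) {C : ℝ}
    (hμs : ∀ᶠ n in atTop, Integrable f (μs n : Measure X) ∧ ∫ x, f x ∂(μs n : Measure X) ≤ C) :
    Integrable f (μ : Measure X) ∧ ∫ x, f x ∂(μ : Measure X) ≤ C := by
  have lintegral_le : ∫⁻ x, ENNReal.ofReal (f x) ∂(μ : Measure X) ≤ ENNReal.ofReal C := by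
    refine (lintegral_le_liminf_lintegral_of_forall_isOpen_measure_le_liminf_measure hf f_nonneg
      fun G hG => ProbabilityMeasure.le_liminf_measure_open_of_tendsto hlim hG).trans ?_
    refine liminf_le_of_frequently_le' (hμs.mono fun n hn => ?_).frequently
    rw [← ofReal_integral_eq_lintegral_ofReal hn.1 (.of_forall f_nonneg)]
    exact ENNReal.ofReal_le_ofReal hn.2
  have integrable_f : Integrable f (μ : Measure X) :=
    (lintegral_ofReal_ne_top_iff_integrable hf.aestronglyMeasurable (.of_forall f_nonneg)).1
      (lintegral_le.trans_lt ENNReal.ofReal_lt_top).ne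
  obtain ⟨n, -, integral_le⟩ := hμs.exists
  refine ⟨integrable_f, ?_⟩
  rwa [← ofReal_integral_eq_lintegral_ofReal integrable_f (.of_forall f_nonneg),
    ENNReal.ofReal_le_ofReal_iff ((integral_nonneg f_nonneg).trans integral_le)] at lintegral_le

/-- The bounded continuous function `h / (1 + ‖h‖ / (k + 1))`. Its distance to `h` is at most
`‖h‖ ^ 2 / (k + 1)`, so it replaces `h` in the integrals of weakly convergent measures with bounded
second moments. -/
noncomputable def damped {X E : Type*} [TopologicalSpace X] [NormedAddCommGroup E]
    [NormedSpace ℝ E] (h : C(X, E)) (k : ℕ) : BoundedContinuousFunction X E :=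
  .ofNormedAddCommGroup (fun x => (1 + ‖h x‖ / (k + 1))⁻¹ • h x)
    (.smul (.inv₀ (by fun_prop) fun x => by positivity) h.continuous) (k + 1) fun x => by
      rw [norm_smul, norm_inv, Real.norm_of_nonneg (by positivity), inv_mul_le_iff₀ (by positivity)]
      field_simp
      linarith

lemma norm_sub_damped_le {X E : Type*} [TopologicalSpace X] [NormedAddCommGroup E]
    [NormedSpace ℝ E] (h : C(X, E)) (k : ℕ) (x : X) :
    ‖h x - damped h k x‖ ≤ ‖h x‖ ^ 2 / (k + 1) := by
  have sub_eq : h x - damped h k x = (1 - (1 + ‖h x‖ / (k + 1))⁻¹) • h x := by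
    rw [sub_smul, one_smul]; rfl
  have one_sub_nonneg : 0 ≤ 1 - (1 + ‖h x‖ / (k + 1))⁻¹ :=
    sub_nonneg.2 (inv_le_one_of_one_le₀ (le_add_of_nonneg_right (by positivity)))
  rw [sub_eq, norm_smul, Real.norm_of_nonneg one_sub_nonneg, sq, mul_div_right_comm]
  refine mul_le_mul_of_nonneg_right ?_ (norm_nonneg _)
  have one_add_pos : 0 < 1 + ‖h x‖ / (k + 1) := by positivity
  rw [sub_le_comm, ← one_div, le_div_iff₀ one_add_pos]
  nlinarith [sq_nonneg (‖h x‖ / (k + 1))]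

lemma norm_integral_sub_integral_damped_le {X E : Type*} [TopologicalSpace X] [MeasurableSpace X]
    [OpensMeasurableSpace X] [NormedAddCommGroup E] [NormedSpace ℝ E] [SecondCountableTopology E]
    [MeasurableSpace E] [BorelSpace E] {ν : Measure X} [IsFiniteMeasure ν] (h : C(X, E))
    (hν : MemLp h 2 ν) (k : ℕ) :
    ‖∫ x, h x ∂ν - ∫ x, damped h k x ∂ν‖ ≤ (∫ x, ‖h x‖ ^ 2 ∂ν) / (k + 1) := by
  rw [← integral_sub (hν.integrable one_le_two) ((damped h k).integrable ν), ← integral_div]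
  exact norm_integral_le_of_norm_le (hν.norm.integrable_sq.div_const _)
    (.of_forall (norm_sub_damped_le h k))

lemma tendsto_integral_of_integral_norm_sq_le {ι X 𝕜 : Type*} [TopologicalSpace X]
    [MeasurableSpace X] [OpensMeasurableSpace X] [RCLike 𝕜] {l : Filter ι}
    {μs : ι → ProbabilityMeasure X} {μ : ProbabilityMeasure X} (hlim : Tendsto μs l (𝓝 μ))
    (h : C(X, 𝕜)) (hμ : MemLp h 2 (μ : Measure X)) {C : ℝ}
    (hμs : ∀ᶠ n in l, MemLp h 2 (μs n : Measure X) ∧ ∫ x, ‖h x‖ ^ 2 ∂(μs n : Measure X) ≤ C) :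
    Tendsto (fun n => ∫ x, h x ∂(μs n : Measure X)) l (𝓝 (∫ x, h x ∂(μ : Measure X))) := by
  rw [Metric.tendsto_nhds]
  intro ε hε
  set D := max C (∫ x, ‖h x‖ ^ 2 ∂(μ : Measure X))
  obtain ⟨k, hk⟩ : ∃ k : ℕ, D / (k + 1) < ε / 3 :=
    (((tendsto_const_nhds (x := D)).div_atTop
      (tendsto_natCast_atTop_atTop.atTop_add tendsto_const_nhds)).eventually_lt_const
        (by positivity)).exists
  have dist_damped_lt {ν : Measure X} [IsFiniteMeasure ν] (hν : MemLp h 2 ν)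
      (integral_le : ∫ x, ‖h x‖ ^ 2 ∂ν ≤ D) :
      dist (∫ x, h x ∂ν) (∫ x, damped h k x ∂ν) < ε / 3 := by
    rw [dist_eq_norm]
    refine (norm_integral_sub_integral_damped_le h hν k).trans_lt (lt_of_le_of_lt ?_ hk)
    gcongr
  have tendsto_damped :=
    (ProbabilityMeasure.tendsto_iff_forall_integral_rclike_tendsto 𝕜).1 hlim (damped h k)
  filter_upwards [hμs, Metric.tendsto_nhds.1 tendsto_damped (ε / 3) (by positivity)]
    with n hn dist_lt
  refine (dist_triangle4_right _ _ (∫ x, damped h k x ∂(μs n : Measure X))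
    (∫ x, damped h k x ∂(μ : Measure X))).trans_lt ?_
  linarith [dist_damped_lt hn.1 (hn.2.trans (le_max_left _ _)),
    dist_damped_lt hμ (le_max_right _ _)]

/-! ### Joint continuity of characteristic functions -/

lemma norm_min_le_right {a b : ℝ} (ha : 0 ≤ a) (hb : 0 ≤ b) : ‖min a b‖ ≤ b := by
  rw [Real.norm_of_nonneg (le_min ha hb)]
  exact min_le_right a b

open BoundedContinuousFunction in
lemma norm_innerProbChar_sub_le {E : Type*} [NormedAddCommGroup E] [InnerProductSpace ℝ E]
    (s t x : E) :
    ‖innerProbChar s x - innerProbChar t x‖ ≤ min (‖s - t‖ * ‖x‖) 2 := by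
  simp only [innerProbChar_apply]
  refine le_min ?_ ((norm_sub_le _ _).trans_eq ?_)
  · have exp_sub_exp :
        Complex.exp (inner ℝ x s * Complex.I) - Complex.exp (inner ℝ x t * Complex.I) =
          (Complex.exp (Complex.I * inner ℝ x (s - t)) - 1) *
            Complex.exp (inner ℝ x t * Complex.I) := by
      rw [sub_one_mul, ← Complex.exp_add, inner_sub_right]
      push_cast
      ring_nf
    rw [exp_sub_exp, norm_mul, Complex.norm_exp_ofReal_mul_I, mul_one, mul_comm ‖s - t‖]
    exact Real.norm_exp_I_mul_ofReal_sub_one_le.trans (norm_inner_le_norm x (s - t))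
  · simp only [Complex.norm_exp_ofReal_mul_I]
    norm_num

lemma dist_charFun_le_integral_min {E : Type*} [NormedAddCommGroup E] [InnerProductSpace ℝ E]
    [MeasurableSpace E] [OpensMeasurableSpace E] (ν : Measure E) [IsFiniteMeasure ν] (s t : E) :
    dist (charFun ν s) (charFun ν t) ≤ ∫ x, min (‖s - t‖ * ‖x‖) 2 ∂ν := by
  rw [charFun_eq_integral_innerProbChar, charFun_eq_integral_innerProbChar, dist_eq_norm,
    ← integral_sub (BoundedContinuousFunction.integrable _ _)
      (BoundedContinuousFunction.integrable _ _)]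
  refine norm_integral_le_of_norm_le ?_ (.of_forall (norm_innerProbChar_sub_le s t))
  refine (integrable_const (2 : ℝ)).mono' (by fun_prop) (.of_forall fun x => ?_)
  exact norm_min_le_right (by positivity) zero_le_two

lemma tendsto_integral_min_mul_norm {E : Type*} [NormedAddCommGroup E] [MeasurableSpace E]
    [OpensMeasurableSpace E] (ν : Measure E) [IsFiniteMeasure ν] :
    Tendsto (fun δ : ℝ => ∫ x, min (δ * ‖x‖) 2 ∂ν) (𝓝[>] 0) (𝓝 0) := by
  suffices Tendsto (fun δ : ℝ => ∫ x, min (δ * ‖x‖) 2 ∂ν) (𝓝[>] 0) (𝓝 (∫ _, 0 ∂ν)) by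
    rwa [integral_zero] at this
  refine tendsto_integral_filter_of_dominated_convergence (fun _ => (2 : ℝ))
    (.of_forall fun δ => by fun_prop) ?_ (integrable_const _) (.of_forall fun x => ?_)
  · filter_upwards [self_mem_nhdsWithin] with δ (hδ : 0 < δ)
    exact .of_forall fun x => norm_min_le_right (by positivity) zero_le_two
  · refine (Continuous.tendsto' ?_ _ _ (by simp)).mono_left nhdsWithin_le_nhds
    fun_prop

open BoundedContinuousFunction in
lemma continuous_charFun_uncurry {E : Type*} [NormedAddCommGroup E] [InnerProductSpace ℝ E]
    [MeasurableSpace E] [OpensMeasurableSpace E] :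
    Continuous fun p : ProbabilityMeasure E × E => charFun (p.1 : Measure E) p.2 := by
  refine continuous_iff_continuousAt.2 fun ⟨μ, t⟩ => Metric.tendsto_nhds.2 fun ε hε => ?_
  obtain ⟨δ, integral_lt, hδ : 0 < δ⟩ := (((tendsto_integral_min_mul_norm
    (μ : Measure E)).eventually_lt_const (half_pos hε)).and self_mem_nhdsWithin).exists
  let φ : BoundedContinuousFunction E ℝ := .ofNormedAddCommGroup (fun x => min (δ * ‖x‖) 2)
    (by fun_prop) 2 fun x => norm_min_le_right (by positivity) zero_le_two
  have integral_φ_lt : ∀ᶠ ν : ProbabilityMeasure E in 𝓝 μ, ∫ x, φ x ∂(ν : Measure E) < ε / 2 :=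
    (ProbabilityMeasure.tendsto_iff_forall_integral_tendsto.1 tendsto_id φ).eventually_lt_const
      integral_lt
  have dist_charFun_lt : ∀ᶠ ν : ProbabilityMeasure E in 𝓝 μ,
      dist (charFun (ν : Measure E) t) (charFun (μ : Measure E) t) < ε / 2 := by
    simp only [charFun_eq_integral_innerProbChar]
    exact Metric.tendsto_nhds.1 ((ProbabilityMeasure.tendsto_iff_forall_integral_rclike_tendsto
      ℂ).1 tendsto_id (innerProbChar t)) _ (half_pos hε)
  rw [nhds_prod_eq]
  filter_upwards [(integral_φ_lt.and dist_charFun_lt).prod_mk (Metric.ball_mem_nhds t hδ)]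
    with ⟨ν, s⟩ ⟨⟨integral_φ_lt, dist_lt⟩, hs⟩
  replace hs : ‖s - t‖ < δ := mem_ball_iff_norm.1 hs
  refine (dist_triangle _ (charFun (ν : Measure E) t) _).trans_lt ?_
  have integral_le : ∫ x, min (‖s - t‖ * ‖x‖) 2 ∂(ν : Measure E) ≤ ∫ x, φ x ∂(ν : Measure E) := by
    refine integral_mono_of_nonneg (.of_forall fun x => by positivity) (φ.integrable _)
      (.of_forall fun x => ?_)
    exact min_le_min_right _ (mul_le_mul_of_nonneg_right hs.le (norm_nonneg x))
  linarith [dist_charFun_le_integral_min (ν : Measure E) s t]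

/-! ### Sub-Gaussian laws and their moment generating functions -/

lemma integrable_exp_mul_sq_gaussianReal {v : NNReal} {b : ℝ} (hb : 2 * b * v < 1) :
    Integrable (fun t : ℝ => Real.exp (b * t ^ 2)) (gaussianReal 0 v) := by
  rcases eq_or_ne v 0 with rfl | hv
  · rw [gaussianReal_zero_var]
    exact integrable_dirac (by simp)
  rw [gaussianReal_of_var_ne_zero 0 hv,
    integrable_withDensity_iff (measurable_gaussianPDF 0 v)
      (.of_forall fun _ => ENNReal.ofReal_lt_top)]
  have rate_pos : 0 < 1 / (2 * v) - b := by
    rw [sub_pos, lt_div_iff₀ (by positivity)]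
    linarith
  refine ((integrable_exp_neg_mul_sq rate_pos).const_mul
    (Real.sqrt (2 * Real.pi * v))⁻¹).congr (.of_forall fun t => ?_)
  simp only [toReal_gaussianPDF, gaussianPDFReal]
  rw [mul_left_comm, ← Real.exp_add]
  congr 2
  ring

lemma isFiniteMeasure_of_hasSubgaussianMGF {Ω : Type*} [MeasurableSpace Ω] {X : Ω → ℝ}
    {μ : Measure Ω} {c : NNReal} (h : HasSubgaussianMGF X c μ) : IsFiniteMeasure μ :=
  (integrable_const_iff_isFiniteMeasure one_ne_zero).1 (by simpa using h.integrable_exp_mul 0)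

lemma measure_setOf_lt_le_ofReal_exp {Ω : Type*} [MeasurableSpace Ω] {X : Ω → ℝ} {μ : Measure Ω}
    {c : NNReal} (h : HasSubgaussianMGF X c μ) {r : ℝ} (hr : 0 ≤ r) :
    μ {ω | r < X ω} ≤ ENNReal.ofReal (Real.exp (-(1 / (2 * c)) * r ^ 2)) := by
  have := isFiniteMeasure_of_hasSubgaussianMGF h
  refine (measure_mono (t := {ω | r ≤ X ω}) fun ω (hω : r < X ω) => hω.le).trans ?_
  rw [← ofReal_measureReal]
  refine ENNReal.ofReal_le_ofReal ((h.measure_ge_le hr).trans_eq ?_)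
  ring_nf

/- Linearize the square: `exp (v x² / 2)` is the moment generating function of the centred Gaussian
law of variance `v` at `x`, and Fubini moves the expectation over `X` inside. -/
lemma integrable_exp_mul_sq_div_two {Ω : Type*} [MeasurableSpace Ω] {X : Ω → ℝ}
    {μ : Measure Ω} {c v : NNReal} (h : HasSubgaussianMGF X c μ) (hcv : c * v < 1) :
    Integrable (fun ω => Real.exp (v * X ω ^ 2 / 2)) μ := by
  have := isFiniteMeasure_of_hasSubgaussianMGF h
  have aemeasurable_X := h.aemeasurable
  have integrable_prod : Integrable (fun p : Ω × ℝ => Real.exp (p.2 * X p.1))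
      (μ.prod (gaussianReal 0 v)) := by
    refine (integrable_prod_iff' ?_).2 ⟨.of_forall h.integrable_exp_mul, ?_⟩
    · exact (Real.measurable_exp.comp_aemeasurable
        (measurable_snd.aemeasurable.mul aemeasurable_X.comp_fst)).aestronglyMeasurable
    · simp only [Real.norm_of_nonneg (Real.exp_nonneg _)]
      refine (integrable_exp_mul_sq_gaussianReal (b := c / 2) ?_).mono'
        (continuous_mgf h.integrable_exp_mul).aestronglyMeasurable (.of_forall fun t => ?_)
      · rw [mul_div_cancel₀ _ two_ne_zero]
        exact_mod_cast hcv
      · change ‖mgf X μ t‖ ≤ _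
        rw [Real.norm_of_nonneg mgf_nonneg, div_mul_eq_mul_div]
        exact h.mgf_le t
  refine integrable_prod.integral_prod_left.congr (.of_forall fun ω => ?_)
  have mgf_gaussian := congrFun (mgf_id_gaussianReal (μ := 0) (v := v)) (X ω)
  simpa only [mgf, id, zero_mul, zero_add, mul_comm (X ω)] using mgf_gaussian

lemma exists_pos_integrable_exp_mul_sq {Ω : Type*} [MeasurableSpace Ω] {X : Ω → ℝ}
    {μ : Measure Ω} {c : NNReal} (h : HasSubgaussianMGF X c μ) :
    ∃ b : ℝ, 0 < b ∧ Integrable (fun ω => Real.exp (b * X ω ^ 2)) μ := by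
  have mul_inv_lt_one : c * (c + 1)⁻¹ < 1 := by
    rw [← div_eq_mul_inv, div_lt_one (by positivity)]
    exact lt_add_one c
  refine ⟨((c + 1)⁻¹ : NNReal) / 2, by positivity, ?_⟩
  simpa only [div_mul_eq_mul_div] using integrable_exp_mul_sq_div_two h mul_inv_lt_one

lemma hasSubgaussianMGF_id_of_tendsto {μs : ℕ → ProbabilityMeasure ℝ} {μ : ProbabilityMeasure ℝ}
    (hlim : Tendsto μs atTop (𝓝 μ)) {c : NNReal}
    (hμs : ∀ᶠ n in atTop, HasSubgaussianMGF id c (μs n : Measure ℝ)) :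
    HasSubgaussianMGF id c (μ : Measure ℝ) := by
  have exp_mul (t : ℝ) := integrable_and_integral_le_of_tendsto hlim
    (f := fun x => Real.exp (t * x)) (by fun_prop) (fun x => (Real.exp_pos _).le)
    (hμs.mono fun n hn => ⟨hn.integrable_exp_mul t, hn.mgf_le t⟩)
  exact ⟨fun t => (exp_mul t).1, fun t => (exp_mul t).2⟩

lemma tendsto_complexMGF_id {ι : Type*} {l : Filter ι} {μs : ι → ProbabilityMeasure ℝ}
    {μ : ProbabilityMeasure ℝ} (hlim : Tendsto μs l (𝓝 μ)) {z : ℂ} {C : ℝ}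
    (hμ : 2 * z.re ∈ integrableExpSet id (μ : Measure ℝ))
    (hμs : ∀ᶠ i in l, 2 * z.re ∈ integrableExpSet id (μs i : Measure ℝ) ∧
      mgf id (μs i : Measure ℝ) (2 * z.re) ≤ C) :
    Tendsto (fun i => complexMGF id (μs i : Measure ℝ) z) l
      (𝓝 (complexMGF id (μ : Measure ℝ) z)) := by
  let h : C(ℝ, ℂ) := ⟨fun x => Complex.exp (z * x), by fun_prop⟩
  have norm_h_sq (x : ℝ) : ‖h x‖ ^ 2 = Real.exp (2 * z.re * x) := by
    change ‖Complex.exp (z * x)‖ ^ 2 = _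
    rw [Complex.norm_exp, Complex.re_mul_ofReal, ← Real.exp_nat_mul, Nat.cast_two, mul_assoc]
  have memLp_h {ν : Measure ℝ} (hν : 2 * z.re ∈ integrableExpSet id ν) : MemLp h 2 ν := by
    rw [memLp_two_iff_integrable_sq_norm h.continuous.aestronglyMeasurable]
    simp only [norm_h_sq]
    exact hν
  refine tendsto_integral_of_integral_norm_sq_le hlim h (memLp_h hμ) (C := C)
    (hμs.mono fun i hi => ⟨memLp_h hi.1, ?_⟩)
  simp only [norm_h_sq]
  exact hi.2

lemma differentiable_complexMGF {Ω : Type*} [MeasurableSpace Ω] {X : Ω → ℝ} {μ : Measure Ω}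
    (h : integrableExpSet X μ = Set.univ) : Differentiable ℂ (complexMGF X μ) := by
  rw [← differentiableOn_univ]
  simpa [h] using differentiableOn_complexMGF (X := X) (μ := μ)

lemma norm_complexMGF_le_exp {Ω : Type*} [MeasurableSpace Ω] {X : Ω → ℝ} {μ : Measure Ω}
    {c : NNReal} (h : HasSubgaussianMGF X c μ) (z : ℂ) :
    ‖complexMGF X μ z‖ ≤ Real.exp (c * z.re ^ 2 / 2) :=
  norm_complexMGF_le_mgf.trans (h.mgf_le z.re)

lemma tendstoLocallyUniformlyOn_complexMGF_id {ι : Type*} {l : Filter ι} [NeBot l]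
    {μs : ι → ProbabilityMeasure ℝ} {μ : ProbabilityMeasure ℝ} (hlim : Tendsto μs l (𝓝 μ))
    {c : NNReal} (hμs : ∀ᶠ i in l, HasSubgaussianMGF id c (μs i : Measure ℝ))
    (hμ : HasSubgaussianMGF id c (μ : Measure ℝ)) :
    TendstoLocallyUniformlyOn (fun i => complexMGF id (μs i : Measure ℝ))
      (complexMGF id (μ : Measure ℝ)) l Set.univ := by
  refine tendstoLocallyUniformlyOn_of_isBoundedUnder_norm isOpen_univ
    (hμs.mono fun i hi =>
      (differentiable_complexMGF hi.integrableExpSet_eq_univ).differentiableOn)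
    (fun z _ => ?_) fun z _ => ?_
  · have bound_lt : ∀ᶠ w in 𝓝 z,
        Real.exp (c * w.re ^ 2 / 2) < Real.exp (c * z.re ^ 2 / 2) + 1 :=
      ContinuousAt.eventually_lt (by fun_prop) (by fun_prop) (lt_add_one _)
    exact ⟨_, eventually_map.2 ((hμs.prod_mk bound_lt).mono fun p hp =>
      (norm_complexMGF_le_exp hp.1 p.2).trans hp.2.le)⟩
  · exact tendsto_complexMGF_id hlim (hμ.integrable_exp_mul _)
      (hμs.mono fun i hi => ⟨hi.integrable_exp_mul _, hi.mgf_le _⟩)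

lemma complexMGF_id_ne_zero_of_tendsto {ι : Type*} {l : Filter ι} [NeBot l]
    {μs : ι → ProbabilityMeasure ℝ} {μ : ProbabilityMeasure ℝ} (hlim : Tendsto μs l (𝓝 μ))
    {c : NNReal} (hμs : ∀ᶠ i in l, HasSubgaussianMGF id c (μs i : Measure ℝ))
    (hμ : HasSubgaussianMGF id c (μ : Measure ℝ)) {z : ℂ} {U : Set ℂ} (hU : U ∈ 𝓝 z)
    (ne_zero : ∀ᶠ i in l, ∀ w ∈ U, complexMGF id (μs i : Measure ℝ) w ≠ 0) :
    complexMGF id (μ : Measure ℝ) z ≠ 0 := by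
  have complexMGF_ne_zero : complexMGF id (μ : Measure ℝ) ≠ 0 := fun h => by
    simpa [complexMGF] using congrFun h 0
  exact ne_zero_of_tendstoLocallyUniformlyOn hU
    (hμs.mono fun i hi =>
      (differentiable_complexMGF hi.integrableExpSet_eq_univ).differentiableOn) ne_zero
    ((tendstoLocallyUniformlyOn_complexMGF_id hlim hμs hμ).mono U.subset_univ)
    (eventually_ne_zero_of_differentiable
      (differentiable_complexMGF hμ.integrableExpSet_eq_univ) complexMGF_ne_zero z)

lemma exists_pos_eventually_le_norm_charFun {E ι : Type*} [NormedAddCommGroup E]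
    [InnerProductSpace ℝ E] [MeasurableSpace E] [OpensMeasurableSpace E] {l : Filter ι}
    {μs : ι → ProbabilityMeasure E} {μ : ProbabilityMeasure E} (hlim : Tendsto μs l (𝓝 μ))
    {r : ℝ} (hr : r < 1) :
    ∃ δ > 0, ∀ᶠ i in l, ∀ y : E, ‖y‖ ≤ δ → r ≤ ‖charFun (μs i : Measure E) y‖ := by
  have lt_norm_charFun : ∀ᶠ p : ProbabilityMeasure E × E in 𝓝 μ ×ˢ 𝓝 0,
      r < ‖charFun (p.1 : Measure E) p.2‖ := by
    rw [← nhds_prod_eq]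
    exact (continuous_charFun_uncurry.norm.tendsto (μ, 0)).eventually_const_lt (by simpa using hr)
  obtain ⟨pa, hpa, pb, hpb, h⟩ := eventually_prod_iff.1 lt_norm_charFun
  obtain ⟨δ, hδ, closedBall_subset⟩ := Metric.nhds_basis_closedBall.eventually_iff.1 hpb
  exact ⟨δ, hδ, (hlim.eventually hpa).mono fun i hi y hy =>
    (h hi (closedBall_subset (mem_closedBall_zero_iff.2 hy))).le⟩

/-! ### Lee-Yang laws -/

lemma mul_le_mul_sq_add_sq_div {b : ℝ} (hb : 0 < b) (t x : ℝ) :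
    t * x ≤ b * x ^ 2 + t ^ 2 / (4 * b) := by
  have sub_eq : b * x ^ 2 + t ^ 2 / (4 * b) - t * x = b * (x - t / (2 * b)) ^ 2 := by
    field_simp
    ring
  rw [← sub_nonneg, sub_eq]
  positivity

lemma integrable_exp_mul_of_integrable_exp_mul_sq {Ω : Type*} [MeasurableSpace Ω] {X : Ω → ℝ}
    {μ : Measure Ω} (hX : AEMeasurable X μ) {b : ℝ} (hb : 0 < b)
    (h : Integrable (fun ω => Real.exp (b * X ω ^ 2)) μ) (t : ℝ) :
    Integrable (fun ω => Real.exp (t * X ω)) μ := by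
  refine (h.mul_const (Real.exp (t ^ 2 / (4 * b)))).mono' (by fun_prop) (.of_forall fun ω => ?_)
  rw [Real.norm_of_nonneg (Real.exp_pos _).le, ← Real.exp_add, Real.exp_le_exp]
  exact mul_le_mul_sq_add_sq_div hb t (X ω)

lemma mgf_le_integral_exp_mul_sq_mul {Ω : Type*} [MeasurableSpace Ω] {X : Ω → ℝ} {μ : Measure Ω}
    {b : ℝ} (hb : 0 < b) (h : Integrable (fun ω => Real.exp (b * X ω ^ 2)) μ) (t : ℝ) :
    mgf X μ t ≤ (∫ ω, Real.exp (b * X ω ^ 2) ∂μ) * Real.exp (t ^ 2 / (4 * b)) := by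
  rw [← integral_mul_const]
  refine integral_mono_of_nonneg (.of_forall fun ω => (Real.exp_pos _).le) (h.mul_const _)
    (.of_forall fun ω => ?_)
  simp only [← Real.exp_add]
  exact Real.exp_le_exp.2 (mul_le_mul_sq_add_sq_div hb t (X ω))

lemma complexMGF_id_neg {ν : Measure ℝ} (hν : ν.map Neg.neg = ν) :
    (complexMGF id ν).Even := fun z => by
  conv_rhs => rw [← hν]
  simp only [complexMGF, id]
  rw [integral_map (by fun_prop) (by fun_prop)]
  simp only [Complex.ofReal_neg, neg_mul_comm]

namespace IsLeeYang

variable {μ : ProbabilityMeasure ℝ}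

lemma integrableExpSet_eq_univ (hμ : IsLeeYang μ) :
    integrableExpSet id (μ : Measure ℝ) = Set.univ := by
  obtain ⟨b, hb, hint⟩ := hμ.exp_sq_integrable
  exact Set.eq_univ_of_forall
    (integrable_exp_mul_of_integrable_exp_mul_sq measurable_id.aemeasurable hb hint)

lemma exists_norm_complexMGF_le (hμ : IsLeeYang μ) :
    ∃ A B : ℝ, ∀ z : ℂ, ‖complexMGF id (μ : Measure ℝ) z‖ ≤ Real.exp (A + B * ‖z‖ ^ 2) := by
  obtain ⟨b, hb, hint⟩ := hμ.exp_sq_integrable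
  set A := ∫ x : ℝ, Real.exp (b * x ^ 2) ∂(μ : Measure ℝ)
  refine ⟨A, 1 / (4 * b), fun z => ?_⟩
  have re_sq_le : z.re ^ 2 ≤ ‖z‖ ^ 2 :=
    sq_le_sq.2 (by simpa only [abs_norm] using Complex.abs_re_le_norm z)
  calc ‖complexMGF id (μ : Measure ℝ) z‖
    _ ≤ mgf id (μ : Measure ℝ) z.re := norm_complexMGF_le_mgf
    _ ≤ A * Real.exp (z.re ^ 2 / (4 * b)) := mgf_le_integral_exp_mul_sq_mul hb hint z.re
    _ ≤ Real.exp A * Real.exp (1 / (4 * b) * ‖z‖ ^ 2) := by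
      rw [one_div_mul_eq_div]
      gcongr
      linarith [Real.add_one_le_exp A]
    _ = Real.exp (A + 1 / (4 * b) * ‖z‖ ^ 2) := (Real.exp_add _ _).symm

lemma eq_im_mul_I_of_complexMGF_eq_zero (hμ : IsLeeYang μ) {z : ℂ}
    (hz : complexMGF id (μ : Measure ℝ) z = 0) : z = z.im * Complex.I :=
  Complex.ext (by simpa using hμ.zeros_imaginary z hz) (by simp)

lemma mgf_rpow_mul_norm_charFun_rpow_le_one (hμ : IsLeeYang μ) {δ : ℝ} (hδ : 0 < δ)
    (ne_zero : ∀ y, |y| < δ → charFun (μ : Measure ℝ) y ≠ 0) {t : ℝ} (ht : t ≠ 0) :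
    mgf id (μ : Measure ℝ) t ^ δ ^ 2 * ‖charFun (μ : Measure ℝ) δ‖ ^ t ^ 2 ≤ 1 := by
  obtain ⟨g, hg, g_sq⟩ := exists_differentiable_comp_sq_eq
    (differentiable_complexMGF hμ.integrableExpSet_eq_univ) (complexMGF_id_neg hμ.symmetric)
  obtain ⟨A, B, norm_le⟩ := hμ.exists_norm_complexMGF_le
  have g_zero : g 0 = 1 := by simpa [complexMGF] using g_sq 0
  have g_sq_real : ‖g (t ^ 2 : ℝ)‖ = mgf id (μ : Measure ℝ) t := by
    rw [Complex.ofReal_pow, g_sq, complexMGF_ofReal, Complex.norm_real,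
      Real.norm_of_nonneg mgf_nonneg]
  have g_neg_sq (y : ℝ) : g (-(y ^ 2 : ℝ)) = charFun (μ : Measure ℝ) y := by
    rw [← complexMGF_id_mul_I, ← g_sq, mul_pow, Complex.I_sq, mul_neg_one, Complex.ofReal_pow]
  have zeros (w : ℂ) (hw : g w = 0) : w.im = 0 ∧ w.re ≤ -δ ^ 2 := by
    obtain ⟨z, rfl⟩ := IsAlgClosed.exists_pow_nat_eq w two_pos
    have sq_eq : z ^ 2 = -(z.im ^ 2 : ℝ) := by
      conv_lhs => rw [hμ.eq_im_mul_I_of_complexMGF_eq_zero ((g_sq z).symm.trans hw)]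
      rw [mul_pow, Complex.I_sq, mul_neg_one, Complex.ofReal_pow]
    rw [sq_eq, g_neg_sq] at hw
    have le_abs_im : δ ≤ |z.im| := not_lt.1 fun h => ne_zero z.im h hw
    rw [sq_eq, ← Complex.ofReal_neg, Complex.ofReal_im, Complex.ofReal_re, neg_le_neg_iff,
      ← sq_abs z.im]
    exact ⟨rfl, pow_le_pow_left₀ hδ.le le_abs_im 2⟩
  have growth (w : ℂ) : ‖g w‖ ≤ Real.exp (A + B * ‖w‖) := by
    obtain ⟨z, rfl⟩ := IsAlgClosed.exists_pow_nat_eq w two_pos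
    simpa only [g_sq, norm_pow] using norm_le z
  have isLittleO : (fun R : ℝ => A + B * R) =o[atTop] fun R => R ^ 2 := by
    simpa only [pow_zero, mul_one, pow_one] using
      ((Asymptotics.isLittleO_pow_pow_atTop_of_lt two_pos).const_mul_left A).add
        ((Asymptotics.isLittleO_pow_pow_atTop_of_lt one_lt_two).const_mul_left B)
  have chord := norm_rpow_mul_norm_rpow_le_one_of_zeros_le hg g_zero zeros growth isLittleO
    (sq_pos_of_ne_zero ht) (sq_pos_of_pos hδ)
  rwa [g_sq_real, g_neg_sq] at chord

lemma hasSubgaussianMGF (hμ : IsLeeYang μ) {δ : ℝ} (hδ : 0 < δ)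
    (half_le : ∀ y, |y| ≤ δ → 1 / 2 ≤ ‖charFun (μ : Measure ℝ) y‖) :
    HasSubgaussianMGF id (2 * Real.log 2 / δ ^ 2).toNNReal (μ : Measure ℝ) := by
  refine ⟨Set.eq_univ_iff_forall.1 hμ.integrableExpSet_eq_univ, fun t => ?_⟩
  rcases eq_or_ne t 0 with rfl | ht
  · simp
  have ne_zero (y : ℝ) (hy : |y| < δ) : charFun (μ : Measure ℝ) y ≠ 0 :=
    norm_pos_iff.1 (half_pos one_pos |>.trans_le (half_le y hy.le))
  have mgf_rpow_le : mgf id (μ : Measure ℝ) t ^ δ ^ 2 ≤ 2 ^ t ^ 2 := by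
    rw [← div_le_one₀ (by positivity), div_eq_mul_inv, ← Real.inv_rpow zero_le_two, ← one_div]
    refine le_trans ?_ (hμ.mgf_rpow_mul_norm_charFun_rpow_le_one hδ ne_zero ht)
    gcongr
    · exact Real.rpow_nonneg mgf_nonneg _
    · exact half_le δ (abs_of_pos hδ).le
  have two_rpow : (2 : ℝ) ^ t ^ 2 = Real.exp (2 * Real.log 2 / δ ^ 2 * t ^ 2 / 2) ^ δ ^ 2 := by
    rw [Real.rpow_def_of_pos two_pos, ← Real.exp_mul]
    field_simp
  rw [Real.coe_toNNReal _ (by positivity)]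
  rwa [two_rpow, Real.rpow_le_rpow_iff mgf_nonneg (Real.exp_pos _).le (by positivity)]
    at mgf_rpow_le

lemma exists_pos_eventually_hasSubgaussianMGF {ι : Type*} {l : Filter ι}
    {μs : ι → ProbabilityMeasure ℝ} (hlim : Tendsto μs l (𝓝 μ)) (hμs : ∀ i, IsLeeYang (μs i)) :
    ∃ c : NNReal, 0 < c ∧ ∀ᶠ i in l, HasSubgaussianMGF id c (μs i : Measure ℝ) := by
  obtain ⟨δ, hδ, half_le⟩ := exists_pos_eventually_le_norm_charFun hlim one_half_lt_one
  exact ⟨_, Real.toNNReal_pos.2 (by positivity),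
    half_le.mono fun i hi => (hμs i).hasSubgaussianMGF hδ hi⟩

end IsLeeYang

theorem mainTheorem1 (μs : ℕ → ProbabilityMeasure ℝ) (μ : ProbabilityMeasure ℝ)
    (hμs : ∀ n, μs n ∈ leeYangClass) (hlim : Tendsto μs atTop (𝓝 μ)) :
    μ ∈ leeYangClass ∧
      ∃ c : ℝ, 0 < c ∧ ∀ r : ℝ, 0 ≤ r →
        (μ : Measure ℝ) (Set.Ioi r) ≤ ENNReal.ofReal (Real.exp (-c * r ^ 2)) := by
  obtain ⟨c, hc, hμs_sub⟩ := IsLeeYang.exists_pos_eventually_hasSubgaussianMGF hlim hμs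
  have hμ_sub : HasSubgaussianMGF id c (μ : Measure ℝ) :=
    hasSubgaussianMGF_id_of_tendsto hlim hμs_sub
  refine ⟨⟨?symmetric, exists_pos_integrable_exp_mul_sq hμ_sub, fun z => ?zeros⟩,
    1 / (2 * c), by positivity, fun r hr => measure_setOf_lt_le_ofReal_exp hμ_sub hr⟩
  case symmetric => exact map_eq_self_of_tendsto hlim continuous_neg fun n => (hμs n).symmetric
  case zeros =>
    contrapose!
    intro hz
    exact complexMGF_id_ne_zero_of_tendsto hlim hμs_sub hμ_sub
      ((isOpen_ne_fun Complex.continuous_re continuous_const).mem_nhds hz)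
      (.of_forall fun n w hw => mt ((hμs n).zeros_imaginary w) hw)
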